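/- Let $k$ be a field, $Q=k[X_1,X_2,X_3]$ with the standard grading, and let $1\le n\le 4$. Let $I\subset Q$ be a homogeneous perfect ideal of grade $3$ (that is, $\operatorname{grade} I=3=\operatorname{pd}_Q Q/I$) of format $(1,5,n+4,n)$, i.e. $Q/I$ has a minimal graded free resolution $$Q \longleftarrow \bigoplus_{i=1}^{5} Q(-d_{1,i}) \longleftarrow \bigoplus_{i=1}^{n+4} Q(-d_{2,i}) \longleftarrow \bigoplus_{i=1}^{n} Q(-d_{3,i}) \longleftarrow 0,$$ with the degrees ordered so that $d_{1,1}\le\cdots\le d_{1,5}$ and $d_{3,1}\le\cdots\le d_{3,n}$. (a) If the initial degree of $I$ (the least degree of a nonzero homogeneous element of $I$) is at least $2$, then $d_{3,n} > d_{1,1}+d_{1,2}$. (b) The ideal $I$ does not satisfy the Huneke–Ulrich numerical obstruction to being licci, i.e. the inequality $d_{3,n}\le 2d_{1,1}$ fails. In particular, this holds for all such ideals of format $(1,5,7,3)$ and $(1,5,8,4)$. -/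

import Mathlib

attribute [local instance] MvPolynomial.gradedAlgebra

/-- The grade of an ideal: the supremum of the lengths of the regular sequences it contains. -/
noncomputable def idealGrade {R : Type*} [CommRing R] (I : Ideal R) : ℕ∞ :=
  sSup {l : ℕ∞ | ∃ rs : List R,
    (∀ r ∈ rs, r ∈ I) ∧ RingTheory.Sequence.IsRegular R rs ∧ (rs.length : ℕ∞) = l}

/-- An ideal `I` is perfect if the projective dimension of `R ⧸ I` equals the grade of `I`. -/
def IsPerfectIdeal {R : Type*} [CommRing R] (I : Ideal R) : Prop :=
  CategoryTheory.projectiveDimension (ModuleCat.of R (R ⧸ I)) = (idealGrade I : WithBot ℕ∞)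

/-- The initial degree of a homogeneous ideal: the least degree of a nonzero form in it. -/
noncomputable def initialDegree {k : Type*} [Field k] {e : ℕ}
    (I : Ideal (MvPolynomial (Fin e) k)) : ℕ :=
  sInf {j : ℕ | ∃ f ∈ I, f ≠ 0 ∧ f.IsHomogeneous j}

/-- `p` is zero or a form of degree `t`, where `t` is an integer
(so only `p = 0` qualifies when `t < 0`). -/
def IsFormOfDegree {k : Type*} [Field k] {e : ℕ} (p : MvPolynomial (Fin e) k) (t : ℤ) : Prop :=
  ∀ c ∈ p.support, (c.degree : ℤ) = t

/-- A minimal graded free resolution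
`Q ← ⨁ i, Q(-d₁ i) ← ⨁ i, Q(-d₂ i) ← ⨁ i, Q(-d₃ i) ← 0`
of `Q ⧸ I` over `Q = k[X₁,…,Xₑ]`, of format `(1, m, b, n)`. The vector `Pi.single j 1` is the
`j`-th element of the standard homogeneous basis, which has degree `d₁ j`, `d₂ j`, `d₃ j`,
respectively. -/
structure MinimalGradedResolution {k : Type*} [Field k] {e : ℕ}
    (I : Ideal (MvPolynomial (Fin e) k)) (m b n : ℕ) where
  /-- The degrees of the basis elements of the first free module. -/
  d₁ : Fin m → ℤ
  /-- The degrees of the basis elements of the second free module. -/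
  d₂ : Fin b → ℤ
  /-- The degrees of the basis elements of the third free module. -/
  d₃ : Fin n → ℤ
  /-- The first differential. -/
  del₁ : (Fin m → MvPolynomial (Fin e) k) →ₗ[MvPolynomial (Fin e) k] MvPolynomial (Fin e) k
  /-- The second differential. -/
  del₂ : (Fin b → MvPolynomial (Fin e) k) →ₗ[MvPolynomial (Fin e) k]
    (Fin m → MvPolynomial (Fin e) k)
  /-- The third differential. -/
  del₃ : (Fin n → MvPolynomial (Fin e) k) →ₗ[MvPolynomial (Fin e) k]
    (Fin b → MvPolynomial (Fin e) k)
  /-- The differentials are homogeneous of degree zero. -/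
  graded₁ : ∀ j, IsFormOfDegree (del₁ (Pi.single j 1)) (d₁ j)
  graded₂ : ∀ i j, IsFormOfDegree (del₂ (Pi.single j 1) i) (d₂ j - d₁ i)
  graded₃ : ∀ i j, IsFormOfDegree (del₃ (Pi.single j 1) i) (d₃ j - d₂ i)
  /-- The complex is a resolution of `Q ⧸ I`. -/
  range₁ : LinearMap.range del₁ = I
  exact₁ : Function.Exact del₂ del₁
  exact₂ : Function.Exact del₃ del₂
  injective₃ : Function.Injective del₃
  /-- The resolution is minimal: all matrix entries lie in `(X₁,…,Xₑ)`. -/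
  minimal₁ : ∀ j, MvPolynomial.constantCoeff (del₁ (Pi.single j 1)) = 0
  minimal₂ : ∀ i j, MvPolynomial.constantCoeff (del₂ (Pi.single j 1) i) = 0
  minimal₃ : ∀ i j, MvPolynomial.constantCoeff (del₃ (Pi.single j 1) i) = 0

/-- The Huneke–Ulrich numerical obstruction `d₃,ₙ ≤ 2 d₁,₁` to being licci, for a resolution whose
degrees `d₁` and `d₃` are listed in nondecreasing order. -/
def MinimalGradedResolution.HunekeUlrichObstruction {k : Type*} [Field k] {e : ℕ}
    {I : Ideal (MvPolynomial (Fin e) k)} {m b n : ℕ} (F : MinimalGradedResolution I m b n)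
    (hm : 0 < m) (hn : 0 < n) : Prop :=
  F.d₃ ⟨n - 1, Nat.sub_lt hn Nat.one_pos⟩ ≤ 2 * F.d₁ ⟨0, hm⟩

/-! Grade 3 in three variables makes `Q ⧸ I` of finite length, so its Hilbert function vanishes in
large degrees. Hence the degrees in the resolution have balanced sums and sums of squares, and with
the equality of ranks their second moments balance about any centre (`sum_degree_identities`).
Minimality supplies matchings in which each `d₁ i`, `i ≠ 0`, lies below its own `d₂`, and each `d₃
l` above its own `d₂`. Put `a = d₁ 0`, `b = d₁ 1`, and suppose every `d₃ l ≤ a + b`. About `c = b +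
5a/8`, the matched `d₂` absorb the squares of the `d₁ i`, `i ≠ 0`, above `c` and of the `d₃ l` below
`c`. The others contribute at most `(5a/8)²` and `(3a/8)²` each. The balance then contradicts `0 < a
≤ b` (`exists_add_lt_of_degree_identities`). So some `d₃ l`, hence the largest, exceeds `a + b ≥
2a`, which gives both claims. -/

/-! ### Grade and finite length -/

open RingTheory.Sequence in
theorem supportDim_add_length_le_of_isWeaklyRegular {R : Type*} [CommRing R] [IsNoetherianRing R]
    {M : Type*} [AddCommGroup M] [Module R M] [Module.Finite R M] (rs : List R)
    (reg : IsWeaklyRegular M rs) :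
    Module.supportDim R (M ⧸ Ideal.ofList rs • (⊤ : Submodule R M)) + rs.length ≤
      Module.supportDim R M := by
  induction rs generalizing M with
  | nil =>
    rw [Ideal.ofList_nil, Submodule.bot_smul]
    simpa using (Module.supportDim_eq_of_equiv (Submodule.quotEquivOfEqBot ⊥ rfl)).le
  | cons x rs ih =>
    obtain ⟨hx, hrs⟩ := (isWeaklyRegular_cons_iff M _ _).mp reg
    have h₁ := ih hrs
    have h₂ := Module.supportDim_quotSMulTop_succ_le_of_notMem_minimalPrimes (M := M) (x := x)
      (fun _ => hx.notMem_of_mem_minimalPrimes)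
    rw [Module.supportDim_eq_of_equiv
      (Submodule.quotOfListConsSMulTopEquivQuotSMulTopInner M x rs)]
    refine le_trans ?_ h₂
    rw [List.length_cons, Nat.cast_succ, ← add_assoc]
    gcongr

open RingTheory.Sequence in
theorem ringKrullDim_quotient_add_length_le_of_isWeaklyRegular {R : Type*} [CommRing R]
    [IsNoetherianRing R] (rs : List R) (reg : IsWeaklyRegular R rs) :
    ringKrullDim (R ⧸ Ideal.ofList rs) + rs.length ≤ ringKrullDim R := by
  have eq : Ideal.ofList rs = Ideal.ofList rs • (⊤ : Ideal R) := by simp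
  rw [ringKrullDim_eq_of_ringEquiv (Ideal.quotientEquivAlgOfEq R eq).toRingEquiv,
    ← Module.supportDim_quotient_eq_ringKrullDim, ← Module.supportDim_self_eq_ringKrullDim]
  exact supportDim_add_length_le_of_isWeaklyRegular rs reg

theorem exists_isRegular_of_idealGrade_eq {R : Type*} [CommRing R] {I : Ideal R} {g : ℕ}
    (hg : 0 < g) (h : idealGrade I = g) :
    ∃ rs : List R, (∀ r ∈ rs, r ∈ I) ∧ RingTheory.Sequence.IsRegular R rs ∧ g ≤ rs.length := by
  have hlt : ((g - 1 : ℕ) : ℕ∞) < idealGrade I := by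
    rw [h]; exact_mod_cast Nat.sub_lt hg one_pos
  obtain ⟨l, ⟨rs, h₁, h₂, rfl⟩, hl⟩ := lt_sSup_iff.mp hlt
  refine ⟨rs, h₁, h₂, ?_⟩
  have : g - 1 < rs.length := by exact_mod_cast hl
  omega

/-- A regular sequence of length at least `e` in `I` cuts the dimension from `e` down to at most
zero. -/
theorem finite_quotient_of_idealGrade_eq {k : Type*} [Field k] {e : ℕ} (he : 0 < e)
    {I : Ideal (MvPolynomial (Fin e) k)} (h : idealGrade I = e) :
    Module.Finite k (MvPolynomial (Fin e) k ⧸ I) := by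
  obtain ⟨rs, hrs, hreg, hlen⟩ := exists_isRegular_of_idealGrade_eq he h
  have h₁ := ringKrullDim_quotient_add_length_le_of_isWeaklyRegular rs hreg.toIsWeaklyRegular
  rw [MvPolynomial.ringKrullDim_of_isNoetherianRing, ringKrullDim_eq_zero_of_field, zero_add,
    Nat.card_eq_fintype_card, Fintype.card_fin] at h₁
  have hle : Ideal.ofList rs ≤ I := Ideal.span_le.mpr hrs
  rw [Module.finite_iff_krullDimLE_zero, Ring.krullDimLE_iff]
  refine (ringKrullDim_le_of_surjective _ (Ideal.Quotient.factor_surjective hle)).trans ?_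
  generalize ringKrullDim (MvPolynomial (Fin e) k ⧸ Ideal.ofList rs) = D at h₁
  induction D using WithBot.recBotCoe with
  | bot => exact bot_le
  | coe D =>
    induction D using ENat.recTopCoe with
    | top =>
      have : (⊤ : ℕ∞) + (rs.length : ℕ∞) ≤ e := by exact_mod_cast h₁
      simp at this
    | coe D =>
      have : D + rs.length ≤ e := by exact_mod_cast h₁
      have : D ≤ 0 := by omega
      exact_mod_cast this

open MvPolynomial in
theorem exists_X_pow_mem {k : Type*} [Field k] {σ : Type*}
    {I : Ideal (MvPolynomial σ k)} (hI : I.IsHomogeneous (homogeneousSubmodule σ k))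
    [Module.Finite k (MvPolynomial σ k ⧸ I)] (i : σ) : ∃ N, X i ^ N ∈ I := by
  obtain ⟨p, hp, hp0⟩ := Algebra.IsIntegral.isIntegral (R := k) (Ideal.Quotient.mk I (X i))
  refine ⟨p.natDegree, ?_⟩
  have hmem : Polynomial.aeval (X i : MvPolynomial σ k) p ∈ I := by
    rw [← Ideal.Quotient.eq_zero_iff_mem]
    change Ideal.Quotient.mkₐ k I _ = 0
    rw [← Polynomial.aeval_algHom_apply]
    exact hp0
  -- Since `p` is monic, this component of `p(X i)` is exactly the leading power of `X i`.
  have := homogeneousComponent_mem_of_mem hI hmem p.natDegree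
  rw [Polynomial.aeval_eq_sum_range, map_sum, Finset.sum_eq_single p.natDegree] at this
  · rwa [map_smul, hp.coeff_natDegree, one_smul,
      homogeneousComponent_of_mem (isHomogeneous_X_pow i _), if_pos rfl] at this
  · intro j _ hj
    rw [map_smul, homogeneousComponent_of_mem (isHomogeneous_X_pow i _), if_neg hj.symm, smul_zero]
  · simp

open MvPolynomial in
theorem exists_forall_form_mem {k : Type*} [Field k] {e : ℕ}
    {I : Ideal (MvPolynomial (Fin e) k)} (hI : I.IsHomogeneous (homogeneousSubmodule (Fin e) k))
    [Module.Finite k (MvPolynomial (Fin e) k ⧸ I)] :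
    ∃ T : ℤ, ∀ t, T ≤ t → ∀ p, IsFormOfDegree p t → p ∈ I := by
  choose N hN using exists_X_pow_mem hI
  refine ⟨∑ i, (N i : ℤ) + 1, fun t ht p hp => ?_⟩
  rw [p.as_sum]
  refine I.sum_mem fun c hc => ?_
  have hdeg := hp c hc
  obtain ⟨i, hi⟩ : ∃ i, N i ≤ c i := by
    by_contra! hcon
    have h₁ : c.degree ≤ ∑ i, N i := by
      rw [Finsupp.degree_eq_sum]
      exact Finset.sum_le_sum fun i _ => (hcon i).le
    have h₂ : (c.degree : ℤ) ≤ ∑ i, (N i : ℤ) := by exact_mod_cast h₁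
    omega
  have : monomial c (coeff c p) = monomial (c - Finsupp.single i (N i)) (coeff c p) * X i ^ N i := by
    rw [X_pow_eq_monomial, monomial_mul, mul_one, tsub_add_cancel_of_le]
    simpa using hi
  rw [this]
  exact I.mul_mem_left _ (hN i)

/-! ### Graded pieces of free modules and homogeneous maps -/

section GradedPieces

open MvPolynomial

variable {k : Type*} [Field k] {e : ℕ}

/-- Weights in `ℤ` allow components to be taken in the degrees `t - d j`, which may be negative. -/
theorem isFormOfDegree_iff_isWeightedHomogeneous {p : MvPolynomial (Fin e) k} {t : ℤ} :
    IsFormOfDegree p t ↔ IsWeightedHomogeneous (1 : Fin e → ℤ) p t := by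
  have hw : ∀ c : Fin e →₀ ℕ, Finsupp.weight (1 : Fin e → ℤ) c = c.degree := fun c => by
    rw [← Nat.cast_id c.degree, Finsupp.degree_eq_weight_one]
    simp [Finsupp.weight_apply, Finsupp.sum]
  simp only [IsFormOfDegree, IsWeightedHomogeneous, mem_support_iff, hw]

theorem IsFormOfDegree.weightedHomogeneousComponent_mul {p : MvPolynomial (Fin e) k} {s : ℤ}
    (hp : IsFormOfDegree p s) (q : MvPolynomial (Fin e) k) (t : ℤ) :
    weightedHomogeneousComponent (1 : Fin e → ℤ) (s + t) (p * q) =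
      p * weightedHomogeneousComponent (1 : Fin e → ℤ) t q := by
  let := weightedGradedAlgebra k (1 : Fin e → ℤ)
  have key : ∀ (x : MvPolynomial (Fin e) k) (m : ℤ),
      (DirectSum.decompose (weightedHomogeneousSubmodule k (1 : Fin e → ℤ)) x m :
        MvPolynomial (Fin e) k) = weightedHomogeneousComponent (1 : Fin e → ℤ) m x :=
    weightedDecomposition.decompose'_apply k (1 : Fin e → ℤ)
  have := DirectSum.coe_decompose_mul_add_of_left_mem
    (weightedHomogeneousSubmodule k (1 : Fin e → ℤ)) (j := t) (b := q)
    (isFormOfDegree_iff_isWeightedHomogeneous.mp hp)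
  rwa [key, key] at this

variable (k e) in
/-- The forms of degree `t` in `k[X₁,…,Xₑ]`. -/
noncomputable def forms (t : ℤ) : Submodule k (MvPolynomial (Fin e) k) :=
  restrictSupport k {c | (c.degree : ℤ) = t}

theorem mem_forms {p : MvPolynomial (Fin e) k} {t : ℤ} : p ∈ forms k e t ↔ IsFormOfDegree p t :=
  mem_restrictSupport_iff k

theorem setOf_degree_eq (t : ℤ) (ht : 0 ≤ t) :
    {c : Fin e →₀ ℕ | (c.degree : ℤ) = t} = ↑((Finset.univ : Finset (Fin e)).finsuppAntidiag t.toNat) := by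
  ext c
  simp only [Set.mem_ofPred_eq, Finset.mem_coe, Finset.mem_finsuppAntidiag, Finset.subset_univ,
    and_true, Finsupp.degree_eq_sum]
  change _ ↔ ∑ i, c i = t.toNat
  omega

instance finite_forms (t : ℤ) : Module.Finite k (forms k e t) := by
  have : Finite {c : Fin e →₀ ℕ | (c.degree : ℤ) = t} := by
    rcases le_or_gt 0 t with ht | ht
    · rw [setOf_degree_eq t ht]; exact Finset.finite_toSet _
    · rw [Set.eq_empty_of_forall_notMem (s := {c : Fin e →₀ ℕ | (c.degree : ℤ) = t})
        fun c (hc : (c.degree : ℤ) = t) => by omega]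
      infer_instance
  exact Module.Finite.of_basis (basisRestrictSupport k {c : Fin e →₀ ℕ | (c.degree : ℤ) = t})

theorem two_mul_finrank_forms_three {t : ℤ} (ht : 0 ≤ t) :
    2 * (Module.finrank k (forms k 3 t) : ℤ) = (t + 1) * (t + 2) := by
  have h₁ : Module.finrank k (forms k 3 t) = (t.toNat + 2).choose 2 := by
    rw [forms, Module.finrank_eq_nat_card_basis (basisRestrictSupport k _), setOf_degree_eq t ht]
    simp only [SetLike.coe_sort_coe, Nat.card_eq_fintype_card, Fintype.card_coe,
      Finset.card_finsuppAntidiag_nat_eq_choose, Finset.card_univ, Fintype.card_fin]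
    rw [show 3 + t.toNat - 1 = t.toNat + 2 by omega, Nat.choose_symm_add]
  lift t to ℕ using ht
  rw [Int.toNat_natCast] at h₁
  have h₂ := Nat.triangle_succ (t + 1)
  rw [h₁, Nat.choose_two_right]
  have h₃ : 2 * ((t + 2) * (t + 2 - 1) / 2) = (t + 2) * (t + 2 - 1) :=
    Nat.mul_div_cancel' (by
      rw [show t + 2 - 1 = t + 1 by omega, mul_comm]; exact (Nat.even_mul_succ_self _).two_dvd)
  rw [show t + 2 - 1 = t + 1 by omega] at h₃ ⊢
  zify at h₃ ⊢
  rw [h₃]; ring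

variable {a b c : ℕ}

variable (k e) in
/-- The degree `t` part of `⨁ j, Q(-d j)`. -/
noncomputable def gradedPiece (d : Fin a → ℤ) (t : ℤ) :
    Submodule k (Fin a → MvPolynomial (Fin e) k) :=
  Submodule.pi Set.univ fun j => forms k e (t - d j)

theorem mem_gradedPiece {d : Fin a → ℤ} {t : ℤ} {v : Fin a → MvPolynomial (Fin e) k} :
    v ∈ gradedPiece k e d t ↔ ∀ j, IsFormOfDegree (v j) (t - d j) := by
  simp [gradedPiece, Submodule.mem_pi, mem_forms]

/-- The degree `t` part of `⨁ j, Q(-d j)` is the product of the pieces of its summands. -/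
noncomputable def gradedPieceEquiv (d : Fin a → ℤ) (t : ℤ) :
    gradedPiece k e d t ≃ₗ[k] ∀ j, forms k e (t - d j) where
  toFun v j := ⟨v.1 j, mem_forms.mpr (mem_gradedPiece.mp v.2 j)⟩
  invFun v := ⟨fun j => v j, mem_gradedPiece.mpr fun j => mem_forms.mp (v j).2⟩
  map_add' _ _ := rfl
  map_smul' _ _ := rfl
  left_inv _ := rfl
  right_inv _ := rfl

instance finite_gradedPiece (d : Fin a → ℤ) (t : ℤ) : Module.Finite k (gradedPiece k e d t) :=
  Module.Finite.equiv (gradedPieceEquiv d t).symm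

theorem finrank_gradedPiece (d : Fin a → ℤ) (t : ℤ) :
    Module.finrank k (gradedPiece k e d t) = ∑ j, Module.finrank k (forms k e (t - d j)) := by
  rw [(gradedPieceEquiv d t).finrank_eq, Module.finrank_pi_fintype]

/-- A homomorphism `⨁ j, Q(-dA j) ⟶ ⨁ i, Q(-dB i)` is homogeneous of degree zero. -/
def IsGradedMap (dA : Fin a → ℤ) (dB : Fin b → ℤ)
    (f : (Fin a → MvPolynomial (Fin e) k) →ₗ[MvPolynomial (Fin e) k]
      (Fin b → MvPolynomial (Fin e) k)) : Prop :=
  ∀ i j, IsFormOfDegree (f (Pi.single j 1) i) (dA j - dB i)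

/-- The component of degree `t` of an element of `⨁ j, Q(-d j)`. -/
noncomputable def vectorComponent (d : Fin a → ℤ) (t : ℤ)
    (v : Fin a → MvPolynomial (Fin e) k) : Fin a → MvPolynomial (Fin e) k :=
  fun j => weightedHomogeneousComponent (1 : Fin e → ℤ) (t - d j) (v j)

theorem vectorComponent_mem (d : Fin a → ℤ) (t : ℤ) (v : Fin a → MvPolynomial (Fin e) k) :
    vectorComponent d t v ∈ gradedPiece k e d t :=
  mem_gradedPiece.mpr fun _ => isFormOfDegree_iff_isWeightedHomogeneous.mpr
    (weightedHomogeneousComponent_isWeightedHomogeneous _ _)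

theorem vectorComponent_of_mem {d : Fin a → ℤ} {t : ℤ} {v : Fin a → MvPolynomial (Fin e) k}
    (hv : v ∈ gradedPiece k e d t) : vectorComponent d t v = v :=
  funext fun j => weightedHomogeneousComponent_eq_self
    (isFormOfDegree_iff_isWeightedHomogeneous.mp (mem_gradedPiece.mp hv j))

variable {dA : Fin a → ℤ} {dB : Fin b → ℤ} {dC : Fin c → ℤ}
  {f : (Fin a → MvPolynomial (Fin e) k) →ₗ[MvPolynomial (Fin e) k]
    (Fin b → MvPolynomial (Fin e) k)}
  {g : (Fin b → MvPolynomial (Fin e) k) →ₗ[MvPolynomial (Fin e) k]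
    (Fin c → MvPolynomial (Fin e) k)}

theorem linearMap_apply_eq_sum (f : (Fin a → MvPolynomial (Fin e) k) →ₗ[MvPolynomial (Fin e) k]
    (Fin b → MvPolynomial (Fin e) k)) (v : Fin a → MvPolynomial (Fin e) k) (i : Fin b) :
    f v i = ∑ j, f (Pi.single j 1) i * v j := by
  conv_lhs => rw [f.pi_apply_eq_sum_univ v]
  rw [Finset.sum_apply]
  refine Finset.sum_congr rfl fun j _ => ?_
  rw [Pi.smul_apply, smul_eq_mul, mul_comm]
  have : (fun x => if j = x then 1 else 0) = (Pi.single j 1 : Fin a → MvPolynomial (Fin e) k) :=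
    funext fun x => by simp only [Pi.single_apply, eq_comm]
  rw [this]

theorem IsGradedMap.map_vectorComponent (hf : IsGradedMap dA dB f) (t : ℤ)
    (v : Fin a → MvPolynomial (Fin e) k) :
    f (vectorComponent dA t v) = vectorComponent dB t (f v) := by
  ext1 i
  rw [vectorComponent, linearMap_apply_eq_sum, linearMap_apply_eq_sum f v, map_sum]
  refine Finset.sum_congr rfl fun j _ => ?_
  rw [show t - dB i = (dA j - dB i) + (t - dA j) by ring,
    (hf i j).weightedHomogeneousComponent_mul]
  rfl

theorem IsGradedMap.map_mem (hf : IsGradedMap dA dB f) {t : ℤ}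
    {v : Fin a → MvPolynomial (Fin e) k} (hv : v ∈ gradedPiece k e dA t) :
    f v ∈ gradedPiece k e dB t := by
  rw [← vectorComponent_of_mem hv, hf.map_vectorComponent]
  exact vectorComponent_mem _ _ _

/-- The degree `t` part of a homogeneous map. -/
noncomputable def IsGradedMap.piece (hf : IsGradedMap dA dB f) (t : ℤ) :
    gradedPiece k e dA t →ₗ[k] gradedPiece k e dB t :=
  (f.restrictScalars k).restrict fun _ hv => hf.map_mem hv

/-- A preimage of a homogeneous vector may be replaced by its degree `t` component, because
homogeneous maps commute with components. -/
theorem IsGradedMap.exact_piece (hf : IsGradedMap dA dB f) (hg : IsGradedMap dB dC g)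
    (h : Function.Exact f g) (t : ℤ) : Function.Exact (hf.piece t) (hg.piece t) := by
  intro v
  constructor
  · intro hv
    obtain ⟨w, hw⟩ := (h v.1).mp (congrArg Subtype.val hv)
    refine ⟨⟨vectorComponent dA t w, vectorComponent_mem _ _ _⟩, Subtype.ext ?_⟩
    change f (vectorComponent dA t w) = v.1
    rw [hf.map_vectorComponent, hw, vectorComponent_of_mem v.2]
  · rintro ⟨w, rfl⟩
    exact Subtype.ext (h.apply_apply_eq_zero w.1)

end GradedPieces

/-- The alternating sum of dimensions along an exact sequence `0 → V₃ → V₂ → V₁ → V₀ → 0`. -/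
theorem finrank_add_finrank_eq_of_exact {k V₃ V₂ V₁ V₀ : Type*} [Field k]
    [AddCommGroup V₃] [Module k V₃] [Module.Finite k V₃]
    [AddCommGroup V₂] [Module k V₂] [Module.Finite k V₂]
    [AddCommGroup V₁] [Module k V₁] [Module.Finite k V₁]
    [AddCommGroup V₀] [Module k V₀]
    {f₃ : V₃ →ₗ[k] V₂} {f₂ : V₂ →ₗ[k] V₁} {f₁ : V₁ →ₗ[k] V₀}
    (h₃ : Function.Injective f₃) (h₂ : Function.Exact f₃ f₂) (h₁ : Function.Exact f₂ f₁)
    (h₀ : Function.Surjective f₁) :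
    Module.finrank k V₀ + Module.finrank k V₂ = Module.finrank k V₁ + Module.finrank k V₃ := by
  have e₁ := f₁.finrank_range_add_finrank_ker
  have e₂ := f₂.finrank_range_add_finrank_ker
  rw [LinearMap.range_eq_top.mpr h₀, finrank_top, h₁.linearMap_ker_eq] at e₁
  rw [h₂.linearMap_ker_eq, LinearMap.finrank_range_of_inj h₃] at e₂
  omega

/-! ### Hilbert function and minimality -/

namespace MinimalGradedResolution

open MvPolynomial

section

variable {k : Type*} [Field k] {e m b n : ℕ} {I : Ideal (MvPolynomial (Fin e) k)}
  (F : MinimalGradedResolution I m b n)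

/-- The first differential, with the free module of rank one as its target. -/
noncomputable def augmentation : (Fin m → MvPolynomial (Fin e) k) →ₗ[MvPolynomial (Fin e) k]
    (Fin 1 → MvPolynomial (Fin e) k) :=
  LinearMap.pi fun _ => F.del₁

theorem isGradedMap_augmentation : IsGradedMap F.d₁ 0 F.augmentation := fun i j => by
  simpa [augmentation] using F.graded₁ j

theorem exact_augmentation : Function.Exact F.del₂ F.augmentation := fun v => by
  rw [← F.exact₁ v]
  simp [augmentation, funext_iff]

theorem finrank_identity {t : ℤ} (ht : ∀ p, IsFormOfDegree p t → p ∈ I) :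
    Module.finrank k (forms k e t) + ∑ j, Module.finrank k (forms k e (t - F.d₂ j)) =
      ∑ i, Module.finrank k (forms k e (t - F.d₁ i)) +
        ∑ l, Module.finrank k (forms k e (t - F.d₃ l)) := by
  have g₃ : IsGradedMap F.d₃ F.d₂ F.del₃ := F.graded₃
  have g₂ : IsGradedMap F.d₂ F.d₁ F.del₂ := F.graded₂
  have hsurj : Function.Surjective (F.isGradedMap_augmentation.piece t) := by
    intro v
    have hv := mem_gradedPiece.mp v.2 0
    rw [Pi.zero_apply, sub_zero] at hv
    obtain ⟨w, hw⟩ : v.1 0 ∈ LinearMap.range F.del₁ := by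
      rw [F.range₁]; exact ht _ hv
    refine ⟨⟨vectorComponent F.d₁ t w, vectorComponent_mem _ _ _⟩, Subtype.ext ?_⟩
    change F.augmentation (vectorComponent F.d₁ t w) = v.1
    rw [F.isGradedMap_augmentation.map_vectorComponent, ← vectorComponent_of_mem v.2]
    congr 1
    ext1 i
    rw [Subsingleton.elim i 0, ← hw]
    rfl
  have hinj : Function.Injective (g₃.piece t) := fun v w h =>
    Subtype.ext (F.injective₃ (congrArg Subtype.val h))
  have := finrank_add_finrank_eq_of_exact hinj (g₃.exact_piece g₂ F.exact₂ t)
    (g₂.exact_piece F.isGradedMap_augmentation F.exact_augmentation t) hsurj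
  have h0 : t - (0 : Fin 1 → ℤ) 0 = t := sub_zero t
  simp only [finrank_gradedPiece, Fin.sum_univ_one] at this
  rwa [h0] at this

/-- Otherwise a basis vector would lie in the image of `del₂`, whose entries have no constant term.
-/
theorem del₁_single_ne_zero (i : Fin m) : F.del₁ (Pi.single i 1) ≠ 0 := by
  intro h
  obtain ⟨w, hw⟩ := (F.exact₁ _).mp h
  have h₁ := congrArg (fun v => constantCoeff (v i)) hw
  simp only [linearMap_apply_eq_sum F.del₂ w, map_sum, map_mul, F.minimal₂, zero_mul,
    Finset.sum_const_zero, Pi.single_eq_same, map_one] at h₁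
  exact zero_ne_one h₁

theorem pos_of_constantCoeff_eq_zero {p : MvPolynomial (Fin e) k} {t : ℤ} (hp : p ≠ 0)
    (hform : IsFormOfDegree p t) (h0 : constantCoeff p = 0) : 0 < t := by
  obtain ⟨c, hc⟩ := support_nonempty.mpr hp
  rw [← hform c hc]
  have : c ≠ 0 := by
    rintro rfl
    exact mem_support_iff.mp hc h0
  have : c.degree ≠ 0 := by rwa [Ne, Finsupp.degree_eq_zero_iff]
  omega

theorem d₁_pos (i : Fin m) : 0 < F.d₁ i :=
  pos_of_constantCoeff_eq_zero (F.del₁_single_ne_zero i) (F.graded₁ i) (F.minimal₁ i)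

end

end MinimalGradedResolution

/-! ### Matchings between the degrees -/

/-- A linearly independent family of vectors admits a matching of its members with coordinates at
which they do not vanish. -/
theorem LinearIndependent.exists_injective_apply_ne_zero {R ι κ : Type*} [CommRing R] [Nontrivial R]
    [Fintype ι] [Fintype κ] {v : ι → κ → R} (hv : LinearIndependent R v) :
    ∃ f : ι → κ, Function.Injective f ∧ ∀ i, v i (f i) ≠ 0 := by
  classical
  -- Hall's condition: the vectors of `A` vanish off `B`, so they stay independent in `B`
  -- coordinates and `|A| ≤ |B|`.
  refine (Fintype.all_card_le_filter_rel_iff_exists_injective fun i j => v i j ≠ 0).mp fun A => ?_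
  set B : Finset κ := {j | ∃ i ∈ A, v i j ≠ 0} with hB
  have hli : LinearIndependent R fun (i : A) (j : B) => v i j := by
    have h₁ := hv.comp ((↑) : A → ι) Subtype.val_injective
    rw [Fintype.linearIndependent_iff] at h₁ ⊢
    intro c hc
    refine h₁ c (funext fun j => ?_)
    by_cases hj : j ∈ B
    · simpa using congrFun hc ⟨j, hj⟩
    · have : ∀ i ∈ A, v i j = 0 := by simpa [hB] using hj
      simp only [Function.comp_apply, Finset.sum_apply, Pi.smul_apply, Pi.zero_apply]
      exact Finset.sum_eq_zero fun i _ => by rw [this i i.2, smul_zero]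
  simpa using hli.fintype_card_le_finrank

namespace MinimalGradedResolution

open MvPolynomial

section

variable {k : Type*} [Field k] {e m b n : ℕ} {I : Ideal (MvPolynomial (Fin e) k)}

theorem exists_injective_d₂_lt_d₃ (F : MinimalGradedResolution I m b n) :
    ∃ g : Fin n → Fin b, Function.Injective g ∧ ∀ l, F.d₂ (g l) < F.d₃ l := by
  have hli : LinearIndependent (MvPolynomial (Fin e) k)
      fun l : Fin n => F.del₃ (Pi.single l 1) := by
    rw [Fintype.linearIndependent_iff]
    intro c hc
    have : F.del₃ c = F.del₃ 0 := by
      rw [map_zero, ← hc]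
      ext1 i
      rw [linearMap_apply_eq_sum, Finset.sum_apply]
      exact Finset.sum_congr rfl fun _ _ => mul_comm _ _
    exact congrFun (F.injective₃ this)
  obtain ⟨g, hg, hne⟩ := hli.exists_injective_apply_ne_zero
  exact ⟨g, hg, fun l => sub_pos.mp
    (pos_of_constantCoeff_eq_zero (hne l) (F.graded₃ _ _) (F.minimal₃ _ _))⟩

/-- The rows of `del₂` other than row 0 are independent: a relation `c` among them kills the image
of `del₂`, hence the Koszul syzygy of generators 0 and `i`, and this reads `c i * del₁ e₀ = 0`. -/
theorem exists_injective_d₁_lt_d₂ (F : MinimalGradedResolution I (m + 1) b n) :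
    ∃ f : Fin m → Fin b, Function.Injective f ∧ ∀ i, F.d₁ i.succ < F.d₂ (f i) := by
  have hli : LinearIndependent (MvPolynomial (Fin e) k)
      fun (i : Fin m) (j : Fin b) => F.del₂ (Pi.single j 1) i.succ := by
    rw [Fintype.linearIndependent_iff]
    intro c hc i
    have hrange : ∀ w, ∑ i : Fin m, c i * F.del₂ w i.succ = 0 := by
      intro w
      simp only [linearMap_apply_eq_sum F.del₂ w, Finset.mul_sum]
      rw [Finset.sum_comm]
      refine Finset.sum_eq_zero fun j _ => ?_
      have := congrFun hc j
      simp only [Finset.sum_apply, Pi.smul_apply, smul_eq_mul, Pi.zero_apply] at this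
      simp only [← mul_assoc, ← Finset.sum_mul, this, zero_mul]
    have hker : F.del₁ (F.del₁ (Pi.single 0 1) • Pi.single i.succ 1 -
        F.del₁ (Pi.single i.succ 1) • Pi.single 0 1) = 0 := by
      simp [mul_comm]
    obtain ⟨w, hw⟩ := (F.exact₁ _).mp hker
    have h₁ := hrange w
    rw [hw, Finset.sum_eq_single i] at h₁
    · simpa [Pi.single_apply, F.del₁_single_ne_zero] using h₁
    · intro j _ hj
      simp [hj]
    · simp
  obtain ⟨f, hf, hne⟩ := hli.exists_injective_apply_ne_zero
  exact ⟨f, hf, fun i => sub_pos.mp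
    (pos_of_constantCoeff_eq_zero (hne i) (F.graded₂ _ _) (F.minimal₂ _ _))⟩

end

/-! ### Linear and quadratic degree identities -/

section

variable {k : Type*} [Field k] {m b n : ℕ} {I : Ideal (MvPolynomial (Fin 3) k)}

/-- The linear and quadratic identities between the degrees in a resolution of a graded quotient of
`k[X₁,X₂,X₃]` of finite length. -/
theorem sum_degree_identities (F : MinimalGradedResolution I m b n) (hrank : b + 1 = m + n)
    {T : ℤ} (hT : ∀ t, T ≤ t → ∀ p, IsFormOfDegree p t → p ∈ I) :
    ∑ j, F.d₂ j = ∑ i, F.d₁ i + ∑ l, F.d₃ l ∧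
      ∑ j, F.d₂ j ^ 2 = ∑ i, F.d₁ i ^ 2 + ∑ l, F.d₃ l ^ 2 := by
  have bound : ∀ {r : ℕ} (d : Fin r → ℤ), ∃ B, ∀ t, B ≤ t → ∀ j, 0 ≤ t - d j := by
    intro r d
    refine ⟨∑ j, |d j|, fun t ht j => ?_⟩
    have := Finset.single_le_sum (f := fun j => |d j|) (fun _ _ => abs_nonneg _)
      (Finset.mem_univ j)
    have := le_abs_self (d j)
    linarith
  obtain ⟨B₁, hB₁⟩ := bound F.d₁
  obtain ⟨B₂, hB₂⟩ := bound F.d₂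
  obtain ⟨B₃, hB₃⟩ := bound F.d₃
  have expand : ∀ {r : ℕ} (d : Fin r → ℤ) (t : ℤ), (∀ j, 0 ≤ t - d j) →
      2 * ((∑ j, Module.finrank k (forms k 3 (t - d j)) : ℕ) : ℤ) =
        r * ((t + 1) * (t + 2)) - (2 * t + 3) * ∑ j, d j + ∑ j, d j ^ 2 := by
    intro r d t h
    push_cast
    rw [Finset.mul_sum, Finset.mul_sum,
      show (r : ℤ) * ((t + 1) * (t + 2)) = ∑ _j : Fin r, (t + 1) * (t + 2) by simp,
      ← Finset.sum_sub_distrib, ← Finset.sum_add_distrib]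
    refine Finset.sum_congr rfl fun j _ => ?_
    rw [two_mul_finrank_forms_three (h j)]
    ring
  set t := |T| + |B₁| + |B₂| + |B₃|
  -- The right side is independent of `s`, so two consecutive values of `s` force the linear defect
  -- to vanish, and then the quadratic one.
  have key : ∀ s, t ≤ s → (2 * s + 3) * (∑ i, F.d₁ i + ∑ l, F.d₃ l - ∑ j, F.d₂ j) =
      ∑ i, F.d₁ i ^ 2 + ∑ l, F.d₃ l ^ 2 - ∑ j, F.d₂ j ^ 2 := by
    intro s hs
    have := abs_nonneg T
    have := abs_nonneg B₁
    have := abs_nonneg B₂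
    have := abs_nonneg B₃
    have := le_abs_self T
    have := le_abs_self B₁
    have := le_abs_self B₂
    have := le_abs_self B₃
    have h := F.finrank_identity (hT s (by linarith))
    have e₀ := two_mul_finrank_forms_three (k := k) (t := s) (by linarith)
    have e₁ := expand F.d₁ s (hB₁ s (by linarith))
    have e₂ := expand F.d₂ s (hB₂ s (by linarith))
    have e₃ := expand F.d₃ s (hB₃ s (by linarith))
    zify at h hrank
    push_cast at e₁ e₂ e₃
    linear_combination e₁ + e₃ - e₀ - e₂ + 2 * h - (s + 1) * (s + 2) * hrank
  have k₁ := key t le_rfl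
  have k₂ := key (t + 1) (by linarith)
  have hlin : ∑ i, F.d₁ i + ∑ l, F.d₃ l - ∑ j, F.d₂ j = 0 := by linarith
  rw [hlin, mul_zero] at k₁
  constructor <;> linarith

end

end MinimalGradedResolution
-- The numerical inequality
theorem sum_comp_le_sum_of_injective {ι κ : Type*} [Fintype ι] [Fintype κ] {f : ι → κ}
    (hf : Function.Injective f) {g : κ → ℤ} (hg : ∀ j, 0 ≤ g j) : ∑ i, g (f i) ≤ ∑ j, g j := by
  classical
  rw [← Finset.sum_image (f := g) (s := Finset.univ) hf.injOn]
  exact Finset.sum_le_univ_sum_of_nonneg hg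

/-- The degrees in a length three resolution of format `(1, 5, n + 4, n)`, `n ≤ 4`, of a module of
finite length satisfy `d₁ 0 + d₁ 1 < d₃ l` for some `l`. -/
theorem exists_add_lt_of_degree_identities {n : ℕ} (hn : n ≤ 4) {d₁ : Fin 5 → ℤ}
    {d₂ : Fin (n + 4) → ℤ} {d₃ : Fin n → ℤ} (hmono : Monotone d₁) (hpos : 0 < d₁ 0)
    (hlin : ∑ j, d₂ j = ∑ i, d₁ i + ∑ l, d₃ l)
    (hsq : ∑ j, d₂ j ^ 2 = ∑ i, d₁ i ^ 2 + ∑ l, d₃ l ^ 2)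
    {f : Fin 4 → Fin (n + 4)} (hf : Function.Injective f) (hf' : ∀ i, d₁ i.succ < d₂ (f i))
    {g : Fin n → Fin (n + 4)} (hg : Function.Injective g) (hg' : ∀ l, d₂ (g l) < d₃ l) :
    ∃ l, d₁ 0 + d₁ 1 < d₃ l := by
  by_contra! hcon
  set a := d₁ 0
  set b := d₁ 1
  have hab : a ≤ b := hmono (by decide)
  have hb : ∀ i : Fin 4, b ≤ d₁ i.succ := fun i => hmono (by simp [Fin.le_def])
  -- This is 8 times the centre `b + s a` with `s = 5/8`. The argument needs `4s² + 4(1-s)² < 2s +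
  -- 1`, that is `1/2 < s < 3/4`, and `5/8` is the midpoint.
  set M := 8 * b + 5 * a with hM
  have hquad : M ^ 2 + ∑ j, (8 * d₂ j - M) ^ 2 =
      (8 * a - M) ^ 2 + ∑ i : Fin 4, (8 * d₁ i.succ - M) ^ 2 + ∑ l, (8 * d₃ l - M) ^ 2 := by
    have expand : ∀ {m : ℕ} (d : Fin m → ℤ), ∑ j, (8 * d j - M) ^ 2 =
        64 * ∑ j, d j ^ 2 - 16 * M * ∑ j, d j + m * M ^ 2 := by
      intro m d
      simp only [sub_sq, Finset.sum_add_distrib, Finset.sum_sub_distrib, Finset.sum_const,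
        Finset.card_univ, Fintype.card_fin, nsmul_eq_mul, Finset.mul_sum]
      congr 2
      · exact Finset.sum_congr rfl fun _ _ => by ring
      · exact Finset.sum_congr rfl fun _ _ => by ring
    have h5 := expand d₁
    rw [Fin.sum_univ_succ] at h5
    have h2 := expand d₂
    have h3 := expand d₃
    push_cast at h2 h3 h5
    rw [h2, h3, hlin, hsq]
    linear_combination -h5
  set pos : ℤ → ℤ := fun d => max (8 * d - M) 0 ^ 2
  set neg : ℤ → ℤ := fun d => max (M - 8 * d) 0 ^ 2
  have hsplit : ∀ d, (8 * d - M) ^ 2 = pos d + neg d := by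
    intro d
    rcases le_total (8 * d) M with h | h
    · simp only [pos, neg, max_eq_right (sub_nonpos.mpr h), max_eq_left (sub_nonneg.mpr h)]; ring
    · simp only [pos, neg, max_eq_right (sub_nonpos.mpr h), max_eq_left (sub_nonneg.mpr h)]; ring
  have h1 : ∑ i : Fin 4, (8 * d₁ i.succ - M) ^ 2 ≤ ∑ i : Fin 4, (25 * a ^ 2 + pos (d₂ (f i))) := by
    refine Finset.sum_le_sum fun i _ => ?_
    rw [hsplit, add_comm]
    refine add_le_add ?_ ?_
    · rw [show 25 * a ^ 2 = (5 * a) ^ 2 by ring]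
      exact pow_le_pow_left₀ (le_max_right _ _)
        (max_le (by linarith [hb i]) (by linarith)) 2
    · exact pow_le_pow_left₀ (le_max_right _ _) (max_le_max (by linarith [hf' i]) le_rfl) 2
  have h3 : ∑ l, (8 * d₃ l - M) ^ 2 ≤ ∑ l, (9 * a ^ 2 + neg (d₂ (g l))) := by
    refine Finset.sum_le_sum fun l _ => ?_
    rw [hsplit]
    refine add_le_add ?_ ?_
    · rw [show 9 * a ^ 2 = (3 * a) ^ 2 by ring]
      exact pow_le_pow_left₀ (le_max_right _ _)
        (max_le (by linarith [hcon l]) (by linarith)) 2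
    · exact pow_le_pow_left₀ (le_max_right _ _) (max_le_max (by linarith [hg' l]) le_rfl) 2
  -- The ranges of `f` and `g` may overlap: one uses only positive parts and the other only negative
  -- parts.
  have h2 : ∑ i, pos (d₂ (f i)) + ∑ l, neg (d₂ (g l)) ≤ ∑ j, (8 * d₂ j - M) ^ 2 := by
    simp only [hsplit, Finset.sum_add_distrib]
    exact add_le_add (sum_comp_le_sum_of_injective hf fun j => sq_nonneg _)
      (sum_comp_le_sum_of_injective hg fun j => sq_nonneg _)
  simp only [Finset.sum_add_distrib, Finset.sum_const, Finset.card_univ, Fintype.card_fin,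
    nsmul_eq_mul] at h1 h3
  have hn' : (n : ℤ) * (9 * a ^ 2) ≤ 4 * (9 * a ^ 2) := by gcongr; exact_mod_cast hn
  push_cast at h1
  have : M ^ 2 ≤ (8 * a - M) ^ 2 + 136 * a ^ 2 := by linarith
  rw [hM] at this
  -- The difference `M² - (8a - M)²` is `128ab + 16a² ≥ 144a²`, which exceeds `136a²`.
  nlinarith
theorem mainTheorem9 {k : Type*} [Field k] (n : ℕ) (hn₁ : 0 < n) (hn₄ : n ≤ 4)
    (I : Ideal (MvPolynomial (Fin 3) k))
    (hI : I.IsHomogeneous (MvPolynomial.homogeneousSubmodule (Fin 3) k))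
    (hperf : IsPerfectIdeal I) (hgrade : idealGrade I = 3)
    (F : MinimalGradedResolution I 5 (n + 4) n)
    (hd₁ : Monotone F.d₁) (hd₃ : Monotone F.d₃) :
    (2 ≤ initialDegree I →
      F.d₁ 0 + F.d₁ 1 < F.d₃ ⟨n - 1, Nat.sub_lt hn₁ Nat.one_pos⟩) ∧
    ¬ F.HunekeUlrichObstruction (by norm_num) hn₁ := by
  have hlt : F.d₁ 0 + F.d₁ 1 < F.d₃ ⟨n - 1, Nat.sub_lt hn₁ Nat.one_pos⟩ := by
    have := finite_quotient_of_idealGrade_eq (by norm_num) hgrade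
    obtain ⟨T, hT⟩ := exists_forall_form_mem hI
    obtain ⟨hlin, hsq⟩ := F.sum_degree_identities (by omega) hT
    obtain ⟨f, hf, hf'⟩ := F.exists_injective_d₁_lt_d₂
    obtain ⟨g, hg, hg'⟩ := F.exists_injective_d₂_lt_d₃
    obtain ⟨l, hl⟩ :=
      exists_add_lt_of_degree_identities hn₄ hd₁ (F.d₁_pos 0) hlin hsq hf hf' hg hg'
    exact hl.trans_le (hd₃ (Fin.le_def.mpr (by simp only; omega)))
  refine ⟨fun _ => hlt, fun h => ?_⟩
  have h₀₁ : F.d₁ 0 ≤ F.d₁ 1 := hd₁ (by decide)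
  have h' : F.d₃ ⟨n - 1, Nat.sub_lt hn₁ Nat.one_pos⟩ ≤ 2 * F.d₁ 0 := h
  linarith
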